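/- Let $Z:\mathbb{R}^3\to\mathbb{R}^3\setminus\{0\}$ be the Zorich-type map given on $[-1,1]^2\times\mathbb{R}$ by $$Z(x_1,x_2,x_3)=e^{x_3}\bigl(x_1,x_2,1-\max\{|x_1|,|x_2|\}\bigr)$$ and extended to $\mathbb{R}^3$ by reflection: every reflection in a plane $x_1=2k+1$ or $x_2=2k+1$ ($k\in\mathbb{Z}$) of the domain corresponds to the reflection in the plane $y_3=0$ of the image. Let $T(x)=x-(1,1,0)$, and let $R_{(2,2)}(x_1,x_2,x_3)=(4-x_1,4-x_2,x_3)$ be the rotation by $\pi$ around the line $\{(2,2,t):t\in\mathbb{R}\}$. Let $L>1$ and let $g:\mathbb{R}^3\to\mathbb{R}^3$ be any map such that 1. $g(x)=x$ whenever $x_3\le 0$; 2. $g(x)=x+Z(x)$ whenever $x_3\ge L$; 3. $g(x+c)=g(x)+c$ for all $x\in\mathbb{R}^3$ and $c\in\{(4,0,0),(0,4,0)\}$; 4. $g(R_{(2,2)}(x))=R_{(2,2)}(g(x))$ for all $x\in\mathbb{R}^3$ (for example the quasiregular map of transcendental type with these properties constructed by Nicks and Sixsmith, with its constant $L$). Define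 $F:\mathbb{R}^3\to\mathbb{R}^3$ by $F(0)=0$ and $F(x)=(Z\circ T\circ g\circ T^{-1}\circ\phi)(x)$ for $x\ne 0$, where $\phi:\mathbb{R}^3\setminus\{0\}\to\mathbb{R}^3$ is any map with $Z\circ\phi=\mathrm{id}$ (any choice of inverse branches of $Z$, not necessarily continuous). Let $M:\mathbb{R}^3\to\mathbb{R}^3\cup\{\infty\}$ be the Möbius map $$M(x_1,x_2,x_3)=\frac{(x_1,x_2,-x_3)}{x_1^2+x_2^2+x_3^2}\quad(x\neq 0),\qquad M(0)=\infty.$$ For $0<\lambda<1$ put $f_\lambda=M\circ\lambda F$ and $L'=\max\{\log(1/\lambda),e^{L}\}$. For $f:\mathbb{R}^3\to\mathbb{R}^3\cup\{\infty\}$ let $BU(f)$ be the set of all $x\in\mathbb{R}^3$ whose iterates $f^n(x)$, $n\ge 0$, are all defined and finite and whose sequence of iterates contains both a bounded subsequence and a subsequence tending to infinity. Then $$\{t(1,1,0):|t|>L'\}\cup\{t(1,1,0):0<|t|<1/(2L')\}\subset BU(f_\lambda).$$ -/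

import Mathlib

open Filter Topology Bornology

noncomputable section

namespace QmDyn

/-- Euclidean three-space. -/
abbrev E3 : Type := EuclideanSpace ℝ (Fin 3)

/-- The index `n` of the strip `2n - 1 ≤ s < 2n + 1` that contains `s`. -/
def cell (s : ℝ) : ℤ := round (s / 2)

/-- The number of reflections in the points `2k + 1` needed to bring `s` to `[-1, 1]`, as a sign. -/
def parity (s : ℝ) : ℝ := (-1 : ℝ) ^ cell s

/-- The point of `[-1, 1]` to which `s` is brought by repeated reflection in the points `2k + 1`:
the triangular wave of period `4` that is the identity on `[-1, 1]`. -/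
def fold (s : ℝ) : ℝ := parity s * (s - 2 * cell s)

/-- The Zorich-type map: on `[-1, 1]² × ℝ` it is
`exp x₃ • (x₁, x₂, 1 - max |x₁| |x₂|)`, and each reflection in a plane `x₁ = 2k + 1` or
`x₂ = 2k + 1` of the domain is matched by the reflection in `y₃ = 0` of the image
(see `zorich_of_mem`, `zorich_reflect_fst`, `zorich_reflect_snd`). -/
def zorich (x : E3) : E3 :=
  Real.exp (x 2) • !₂[fold (x 0), fold (x 1),
    parity (x 0) * parity (x 1) * (1 - max |fold (x 0)| |fold (x 1)|)]

/-- Rotation by `π` around the line `{(u, v, t) : t ∈ ℝ}`. -/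
def rot (u v : ℝ) (x : E3) : E3 := !₂[2 * u - x 0, 2 * v - x 1, x 2]

/-- The translation `x ↦ x - (1, 1, 0)`. -/
def T (x : E3) : E3 := x - !₂[1, 1, 0]

/-- The inverse translation `x ↦ x + (1, 1, 0)`. -/
def Tinv (x : E3) : E3 := x + !₂[1, 1, 0]

/-- `φ` selects, for every nonzero `x`, a preimage of `x` under the Zorich-type map. No continuity
is asked for, so every way of choosing inverse branches point by point is covered. -/
def IsInverseBranch (φ : E3 → E3) : Prop := ∀ x : E3, x ≠ 0 → zorich (φ x) = x

open Classical in
/-- The map `F`: `F 0 = 0` and `F = Z ∘ T ∘ g ∘ T⁻¹ ∘ φ` away from `0`. -/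
def bigF (g φ : E3 → E3) (x : E3) : E3 :=
  if x = 0 then 0 else zorich (T (g (Tinv (φ x))))

open Classical in
/-- The Möbius map `M x = (x₁, x₂, -x₃) / |x|²`, with `M 0 = ∞`. -/
def mobius (x : E3) : OnePoint E3 :=
  if x = 0 then OnePoint.infty
  else (((‖x‖ ^ 2)⁻¹ • !₂[x 0, x 1, -x 2] : E3) : OnePoint E3)

/-- The map `f_λ = M ∘ λF`. -/
def qmMap (lam : ℝ) (g φ : E3 → E3) (x : E3) : OnePoint E3 := mobius (lam • bigF g φ x)

/-- `BU f`: the points all of whose iterates under `f : ℝ³ → ℝ³ ∪ {∞}` are defined and finite, and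
whose sequence of iterates has both a bounded subsequence and a subsequence tending to infinity. -/
def BU (f : E3 → OnePoint E3) : Set E3 :=
  {x | ∃ u : ℕ → E3, u 0 = x ∧ (∀ n, f (u n) = ((u (n + 1) : E3) : OnePoint E3)) ∧
    (∃ a : ℕ → ℕ, StrictMono a ∧ IsBounded (Set.range (u ∘ a))) ∧
    (∃ b : ℕ → ℕ, StrictMono b ∧ Tendsto (fun n => ‖u (b n)‖) atTop atTop)}

theorem cell_of_mem {s : ℝ} (h₁ : -1 ≤ s) (h₂ : s < 1) : cell s = 0 := by
  unfold cell
  rw [round_eq, Int.floor_eq_iff]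
  constructor <;> push_cast <;> linarith

theorem cell_one : cell 1 = 1 := by
  unfold cell
  rw [round_eq, Int.floor_eq_iff]
  constructor <;> push_cast <;> norm_num

theorem fold_of_mem {s : ℝ} (h₁ : -1 ≤ s) (h₂ : s ≤ 1) : fold s = s := by
  rcases h₂.lt_or_eq with h | rfl
  · simp [fold, parity, cell_of_mem h₁ h]
  · norm_num [fold, parity, cell_one]

theorem zorich_of_mem (x : E3) (h₀ : |x 0| ≤ 1) (h₁ : |x 1| ≤ 1) :
    zorich x = Real.exp (x 2) • !₂[x 0, x 1, 1 - max |x 0| |x 1|] := by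
  obtain ⟨a, b⟩ := abs_le.1 h₀
  obtain ⟨c, d⟩ := abs_le.1 h₁
  unfold zorich
  rw [fold_of_mem a b, fold_of_mem c d]
  rcases b.lt_or_eq with hb | hb <;> rcases d.lt_or_eq with hd | hd
  · simp [parity, cell_of_mem a hb, cell_of_mem c hd]
  · simp [hd, h₀]
  · simp [hb, h₁]
  · simp [hb, hd]

theorem cell_reflect (k : ℤ) (s : ℝ) :
    (cell (2 * (2 * k + 1) - s) = 2 * k + 1 - cell s) ∨
      (cell (2 * (2 * k + 1) - s) = 2 * k + 2 - cell s ∧ s - 2 * cell s = -1) := by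
  have e : ((cell s : ℤ) : ℝ) ≤ s / 2 + 1 / 2 ∧ s / 2 + 1 / 2 < cell s + 1 := by
    unfold cell
    rw [round_eq]
    exact ⟨Int.floor_le _, Int.lt_floor_add_one _⟩
  rcases e.1.lt_or_eq with h | h
  · left
    rw [cell, round_eq, Int.floor_eq_iff]
    push_cast
    constructor <;> linarith [e.2]
  · right
    refine ⟨?_, by linarith⟩
    rw [cell, round_eq, Int.floor_eq_iff]
    push_cast
    constructor <;> linarith

theorem fold_reflect (k : ℤ) (s : ℝ) : fold (2 * (2 * k + 1) - s) = fold s ∧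
    (parity (2 * (2 * k + 1) - s) = -parity s ∨ |fold s| = 1) := by
  have o (m : ℤ) : (-1 : ℝ) ^ (2 * k + 1 - m) = -(-1) ^ m := by
    rw [show 2 * k + 1 - m = 2 * (k - m) + 1 + m by ring, zpow_add₀ (by norm_num),
      zpow_add₀ (by norm_num), zpow_mul]
    norm_num
  have o' (m : ℤ) : (-1 : ℝ) ^ (2 * k + 2 - m) = (-1) ^ m := by
    rw [show 2 * k + 2 - m = 2 * (k + 1 - m) + m by ring, zpow_add₀ (by norm_num), zpow_mul]
    norm_num
  rcases cell_reflect k s with h | ⟨h, hs⟩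
  · refine ⟨?_, Or.inl ?_⟩
    · simp only [fold, parity, h, o]
      push_cast
      ring
    · simp only [parity, h, o]
  · refine ⟨?_, Or.inr ?_⟩
    · simp only [fold, parity, h, o']
      push_cast
      rw [show s = 2 * cell s - 1 by linarith]
      have : cell (2 * (cell s : ℝ) - 1) = cell s := by
        rw [show 2 * (cell s : ℝ) - 1 = s by linarith]
      rw [this]
      ring
    · simp [fold, parity, hs, abs_zpow]

theorem abs_fold_le (s : ℝ) : |fold s| ≤ 1 := by
  have := abs_sub_round (s / 2)
  have h : s - 2 * (cell s : ℝ) = 2 * (s / 2 - round (s / 2)) := by unfold cell; ring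
  rw [fold, parity, abs_mul, abs_zpow, abs_neg, abs_one, one_zpow, one_mul, h, abs_mul, abs_two]
  linarith

theorem zorich_reflect_fst (k : ℤ) (a b c : ℝ) :
    zorich !₂[2 * (2 * k + 1) - a, b, c] =
      !₂[zorich !₂[a, b, c] 0, zorich !₂[a, b, c] 1, -zorich !₂[a, b, c] 2] := by
  obtain ⟨h, h' | h'⟩ := fold_reflect k a
  · ext i; fin_cases i <;> simp [zorich, h, h']
  · ext i; fin_cases i <;> simp [zorich, h, h', abs_fold_le]

theorem zorich_reflect_snd (k : ℤ) (a b c : ℝ) :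
    zorich !₂[a, 2 * (2 * k + 1) - b, c] =
      !₂[zorich !₂[a, b, c] 0, zorich !₂[a, b, c] 1, -zorich !₂[a, b, c] 2] := by
  obtain ⟨h, h' | h'⟩ := fold_reflect k b
  · ext i; fin_cases i <;> simp [zorich, h, h']
  · ext i; fin_cases i <;> simp [zorich, h, h', abs_fold_le]

end QmDyn

end

open Filter Topology Bornology

noncomputable section

namespace QmDyn

/-! The diagonal `t • (1, 1, 0)` carries one-dimensional dynamics that do not depend on the branch
`φ`. All `zorich`-preimages of a diagonal point lie at height `log |t|` over `±(1, 1) + 4ℤ²`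
(`zorich_eq_diagonal`). `Tinv` moves them to lines where `zorich` points straight up
(`zorich_Tinv`), so for `|t| ≥ exp L` the map `g` only lifts by `|t|`, and `F` acts as `τ : t ↦ t *
exp |t|`. For `|t| ≤ 1` it acts as the identity. Since `mobius` acts as `t ↦ 1 / (2 * t)`, a large
`t` goes to `1 / (2 * lam * τ t)`, which has modulus at most `1`, and from there to `τ t`. Hence
even iterates escape and odd ones stay bounded; small nonzero parameters enter the outer range after
one step. -/

theorem cell_add_four_mul (s : ℝ) (m : ℤ) : cell (s + 4 * m) = cell s + 2 * m := by
  unfold cell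
  rw [show (s + 4 * m) / 2 = s / 2 + ((2 * m : ℤ) : ℝ) by push_cast; ring, round_add_intCast]

theorem parity_add_four_mul (s : ℝ) (m : ℤ) : parity (s + 4 * m) = parity s := by
  unfold parity
  rw [cell_add_four_mul, zpow_add₀ (by norm_num), zpow_mul]
  norm_num

theorem fold_add_four_mul (s : ℝ) (m : ℤ) : fold (s + 4 * m) = fold s := by
  unfold fold
  rw [parity_add_four_mul, cell_add_four_mul]
  push_cast
  ring

theorem cell_two : cell 2 = 1 := by norm_num [cell]

theorem parity_zero : parity 0 = 1 := by simp [parity, cell]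

theorem parity_two : parity 2 = -1 := by simp [parity, cell_two]

theorem fold_zero : fold 0 = 0 := fold_of_mem (by norm_num) (by norm_num)

theorem fold_two : fold 2 = 0 := by simp [fold, cell_two]

/-- The folding map takes the value `1` only on `1 + 4ℤ`, and `-1` only on `-1 + 4ℤ`. -/
theorem exists_of_fold_eq {s ε : ℝ} (hε : ε = 1 ∨ ε = -1) (h : fold s = ε) :
    ∃ m : ℤ, s = ε + 4 * m := by
  unfold fold parity at h
  obtain ⟨k, hk | hk⟩ := Int.even_or_odd' (cell s)
  · rw [hk, zpow_mul] at h
    norm_num at h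
    exact ⟨k, by linarith⟩
  · rw [hk, zpow_add₀ (by norm_num), zpow_mul] at h
    norm_num at h
    rcases hε with rfl | rfl
    · exact ⟨k, by linarith⟩
    · exact ⟨k + 1, by push_cast; linarith⟩

/-- The preimages of `t • (1, 1, 0)` under the Zorich-type map. -/
theorem zorich_eq_diagonal {p : E3} {t : ℝ}
    (h : zorich p = t • !₂[1, 1, 0]) :
    ∃ ε : ℝ, (ε = 1 ∨ ε = -1) ∧ (∃ m : ℤ, p 0 = ε + 4 * m) ∧ (∃ n : ℤ, p 1 = ε + 4 * n) ∧
      Real.exp (p 2) = |t| := by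
  have h0 : Real.exp (p 2) * fold (p 0) = t := by simpa [zorich] using congrArg (· 0) h
  have h1 : Real.exp (p 2) * fold (p 1) = t := by simpa [zorich] using congrArg (· 1) h
  have h2 : parity (p 0) * parity (p 1) * (1 - max |fold (p 0)| |fold (p 1)|) = 0 := by
    simpa [zorich] using congrArg (· 2) h
  have he := Real.exp_pos (p 2)
  have h01 : fold (p 1) = fold (p 0) := mul_left_cancel₀ he.ne' (h1.trans h0.symm)
  have hpar (s : ℝ) : parity s ≠ 0 := zpow_ne_zero _ (by norm_num)
  -- Parities never vanish, so a zero third coordinate forces the maximum to be `1`.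
  have habs : |fold (p 0)| = 1 := by
    have := (mul_eq_zero.1 h2).resolve_left (mul_ne_zero (hpar _) (hpar _))
    rw [h01, max_self] at this
    linarith
  have hε : fold (p 0) = 1 ∨ fold (p 0) = -1 := eq_or_eq_neg_of_abs_eq habs
  refine ⟨fold (p 0), hε, exists_of_fold_eq hε rfl, exists_of_fold_eq hε h01, ?_⟩
  rw [← h0, abs_mul, habs, mul_one, abs_of_pos he]

/-- On the vertical lines over `(1, 1) + 4ℤ²` and `(-1, -1) + 4ℤ²`, moved by `(1, 1, 0)`, the
Zorich-type map takes values on the positive `x₃`-axis. -/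
theorem zorich_Tinv {p : E3} {ε : ℝ} (hε : ε = 1 ∨ ε = -1) {m n : ℤ}
    (h0 : p 0 = ε + 4 * m) (h1 : p 1 = ε + 4 * n) :
    zorich (Tinv p) = Real.exp (p 2) • !₂[0, 0, 1] := by
  have e0 : Tinv p 0 = (ε + 1) + 4 * m := by simp [Tinv, h0]; ring
  have e1 : Tinv p 1 = (ε + 1) + 4 * n := by simp [Tinv, h1]; ring
  have e2 : Tinv p 2 = p 2 := by simp [Tinv]
  unfold zorich
  rw [e0, e1, e2, fold_add_four_mul, fold_add_four_mul, parity_add_four_mul, parity_add_four_mul]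
  -- The line lies over `(2, 2)` or `(0, 0)` modulo `4`; the two parities agree, so their product is
  -- `1` and the image points upwards in both cases.
  rcases hε with rfl | rfl
  · norm_num [fold_two, parity_two]
  · norm_num [fold_zero, parity_zero]

/-- Height enters only through the exponential factor; this turns the lift by `|t|` into the factor
`exp |t|` in `F`. -/
theorem zorich_add_vertical (p : E3) (c : ℝ) :
    zorich (p + c • !₂[0, 0, 1]) = Real.exp c • zorich p := by
  unfold zorich
  rw [smul_smul, ← Real.exp_add]
  simp [add_comm]

theorem diagonal_ne_zero {t : ℝ} (ht : t ≠ 0) : (t • !₂[1, 1, 0] : E3) ≠ 0 := fun h =>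
  ht (by simpa using congrArg (· 0) h)

/-- `F` is the identity on the part of the diagonal near `0`. -/
theorem bigF_diagonal_of_le_one {g φ : E3 → E3} (hg : ∀ x : E3, x 2 ≤ 0 → g x = x)
    (hφ : IsInverseBranch φ) {t : ℝ} (ht : t ≠ 0) (ht1 : |t| ≤ 1) :
    bigF g φ (t • !₂[1, 1, 0]) = t • !₂[1, 1, 0] := by
  have hx := diagonal_ne_zero ht
  obtain ⟨-, -, -, -, he⟩ := zorich_eq_diagonal (hφ _ hx)
  have h2 : Tinv (φ (t • !₂[1, 1, 0])) 2 ≤ 0 := by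
    have : φ (t • !₂[1, 1, 0]) 2 ≤ 0 := Real.exp_le_one_iff.1 (he.trans_le ht1)
    simpa [Tinv] using this
  rw [bigF, if_neg hx, hg _ h2, T, Tinv, add_sub_cancel_right, hφ _ hx]

/-- `F` is `t • (1, 1, 0) ↦ t exp |t| • (1, 1, 0)` on the part of the diagonal far from `0`. -/
theorem bigF_diagonal_of_exp_le {L : ℝ} {g φ : E3 → E3}
    (hg : ∀ x : E3, L ≤ x 2 → g x = x + zorich x) (hφ : IsInverseBranch φ) {t : ℝ}
    (ht : Real.exp L ≤ |t|) :
    bigF g φ (t • !₂[1, 1, 0]) = (Real.exp |t| * t) • !₂[1, 1, 0] := by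
  have ht0 : t ≠ 0 := abs_pos.1 ((Real.exp_pos L).trans_le ht)
  have hx := diagonal_ne_zero ht0
  obtain ⟨ε, hε, ⟨m, hm⟩, ⟨n, hn⟩, he⟩ := zorich_eq_diagonal (hφ _ hx)
  have h2 : L ≤ Tinv (φ (t • !₂[1, 1, 0])) 2 := by
    have : L ≤ φ (t • !₂[1, 1, 0]) 2 := Real.exp_le_exp.1 (ht.trans_eq he.symm)
    simpa [Tinv] using this
  rw [bigF, if_neg hx, hg _ h2, zorich_Tinv hε hm hn, he, T, Tinv, add_right_comm,
    add_sub_cancel_right, zorich_add_vertical, hφ _ hx, smul_smul]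

theorem mobius_diagonal {t : ℝ} (ht : t ≠ 0) :
    mobius (t • !₂[1, 1, 0]) = (((1 / (2 * t)) • !₂[1, 1, 0] : E3) : OnePoint E3) := by
  have hn : ‖(t • !₂[1, 1, 0] : E3)‖ ^ 2 = 2 * t ^ 2 := by
    rw [EuclideanSpace.norm_sq_eq]
    simp [Fin.sum_univ_three]
    ring
  rw [mobius, if_neg (diagonal_ne_zero ht), hn]
  congr 1
  ext i
  fin_cases i <;> simp <;> field_simp

theorem qmMap_diagonal_of_le_one {g φ : E3 → E3} (hg : ∀ x : E3, x 2 ≤ 0 → g x = x)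
    (hφ : IsInverseBranch φ) {lam : ℝ} (hlam : 0 < lam) {t : ℝ} (ht : t ≠ 0) (ht1 : |t| ≤ 1) :
    qmMap lam g φ (t • !₂[1, 1, 0]) =
      (((1 / (2 * (lam * t))) • !₂[1, 1, 0] : E3) : OnePoint E3) := by
  rw [qmMap, bigF_diagonal_of_le_one hg hφ ht ht1, smul_smul,
    mobius_diagonal (mul_ne_zero hlam.ne' ht)]

theorem qmMap_diagonal_of_exp_le {L : ℝ} {g φ : E3 → E3}
    (hg : ∀ x : E3, L ≤ x 2 → g x = x + zorich x) (hφ : IsInverseBranch φ) {lam : ℝ}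
    (hlam : 0 < lam) {t : ℝ} (ht : Real.exp L ≤ |t|) :
    qmMap lam g φ (t • !₂[1, 1, 0]) =
      (((1 / (2 * (lam * (Real.exp |t| * t)))) • !₂[1, 1, 0] : E3) : OnePoint E3) := by
  have ht0 : t ≠ 0 := abs_pos.1 ((Real.exp_pos L).trans_le ht)
  rw [qmMap, bigF_diagonal_of_exp_le hg hφ ht, smul_smul,
    mobius_diagonal (mul_ne_zero hlam.ne' (mul_ne_zero (Real.exp_pos _).ne' ht0))]

theorem mem_BU_of_map_mem {f : E3 → OnePoint E3} {x y : E3} (h : f x = (y : OnePoint E3))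
    (hy : y ∈ BU f) : x ∈ BU f := by
  obtain ⟨u, hu0, hu, ⟨a, ha, hab⟩, b, hb, hbt⟩ := hy
  refine ⟨fun n => Nat.casesOn n x u, rfl, ?_, ⟨fun n => a n + 1, fun _ _ hij =>
    Nat.succ_lt_succ (ha hij), hab⟩, fun n => b n + 1, fun _ _ hij => Nat.succ_lt_succ (hb hij), hbt⟩
  rintro (_ | n)
  · simpa [hu0] using h
  · exact hu n

/-- A point lies in `BU f` if its even iterates tend to infinity and its odd iterates stay
bounded. -/
theorem mem_BU_of_alternating {f : E3 → OnePoint E3} (v w : ℕ → E3)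
    (hvw : ∀ n, f (v n) = (w n : OnePoint E3)) (hwv : ∀ n, f (w n) = (v (n + 1) : OnePoint E3))
    (hw : IsBounded (Set.range w)) (hv : Tendsto (fun n => ‖v n‖) atTop atTop) : v 0 ∈ BU f := by
  have hodd (n : ℕ) : ¬ Even (2 * n + 1) := by simp
  have hdiv (n : ℕ) : (2 * n + 1) / 2 = n := by omega
  have hdiv' (n : ℕ) : (2 * n + 1 + 1) / 2 = n + 1 := by omega
  refine ⟨fun n => if Even n then v (n / 2) else w (n / 2), by simp, fun n => ?_,
    ⟨fun n => 2 * n + 1, fun _ _ _ => by dsimp only; omega, ?_⟩,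
    fun n => 2 * n, fun _ _ _ => by dsimp only; omega, ?_⟩
  · obtain ⟨k, rfl | rfl⟩ := Nat.even_or_odd' n
    · simpa [hodd, hdiv] using hvw k
    · have : Even (2 * k + 1 + 1) := ⟨k + 1, by ring⟩
      simpa only [if_neg (hodd k), if_pos this, hdiv, hdiv'] using hwv k
  · convert hw using 2
    ext n : 1
    simp [hdiv]
  · simpa using hv

/-- Points on the diagonal far from `0` are mapped close to `0`, and from there further out. -/
theorem diagonal_mem_BU {L : ℝ} (hL : 1 < L) {g φ : E3 → E3}
    (hg₀ : ∀ x : E3, x 2 ≤ 0 → g x = x) (hg : ∀ x : E3, L ≤ x 2 → g x = x + zorich x)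
    (hφ : IsInverseBranch φ) {lam : ℝ} (hlam : 0 < lam) {t : ℝ}
    (ht : max (Real.log (1 / lam)) (Real.exp L) < |t|) :
    t • !₂[1, 1, 0] ∈ BU (qmMap lam g φ) := by
  set τ : ℝ → ℝ := fun s => Real.exp |s| * s
  have hone : 1 < Real.exp L := Real.one_lt_exp_iff.2 (by linarith)
  have habs (s : ℝ) : |τ s| = Real.exp |s| * |s| := by simp [τ, abs_mul]
  have hgrow (s : ℝ) (hs : Real.exp L < |s|) : 2 * |s| ≤ |τ s| := by
    rw [habs]
    have := Real.add_one_le_exp |s|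
    gcongr
    linarith
  have hmem (n : ℕ) : max (Real.log (1 / lam)) (Real.exp L) < |τ^[n] t| ∧
      2 ^ n ≤ |τ^[n] t| := by
    induction n with
    | zero => exact ⟨ht, by simpa using (hone.trans ((le_max_right _ _).trans_lt ht)).le⟩
    | succ n ih =>
      rw [Function.iterate_succ_apply']
      have := hgrow _ ((le_max_right _ _).trans_lt ih.1)
      exact ⟨by linarith [ih.1, abs_nonneg (τ^[n] t)], by rw [pow_succ]; linarith [ih.2]⟩
  have hlarge (n : ℕ) : Real.exp L < |τ^[n] t| := (le_max_right _ _).trans_lt (hmem n).1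
  have hne (n : ℕ) : τ^[n] t ≠ 0 := abs_pos.1 ((Real.exp_pos L).trans (hlarge n))
  set σ : ℕ → ℝ := fun n => 1 / (2 * (lam * τ (τ^[n] t)))
  have hσ0 (n : ℕ) : σ n ≠ 0 := by
    have : τ (τ^[n] t) ≠ 0 := mul_ne_zero (Real.exp_pos _).ne' (hne n)
    have := hlam.ne'
    positivity
  have hσ (n : ℕ) : |σ n| ≤ 1 := by
    -- This is where the term `log (1 / lam)` in the threshold is needed.
    have h1 : 1 ≤ lam * Real.exp |τ^[n] t| := by
      have h := (Real.log_le_iff_le_exp (by positivity)).1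
        ((le_max_left _ _).trans (hmem n).1.le)
      rwa [div_le_iff₀' hlam] at h
    have h2 : 1 ≤ |τ^[n] t| := (hone.trans (hlarge n)).le
    have h3 : 1 ≤ 2 * (lam * |τ (τ^[n] t)|) := by
      rw [habs]
      nlinarith
    simp only [σ, abs_div, abs_mul, abs_one, abs_two, abs_of_pos hlam]
    exact (div_le_one (by linarith)).2 h3
  refine mem_BU_of_alternating (fun n => τ^[n] t • (!₂[1, 1, 0] : E3))
    (fun n => σ n • (!₂[1, 1, 0] : E3))
    (fun n => qmMap_diagonal_of_exp_le hg hφ hlam (hlarge n).le) (fun n => ?_) ?_ ?_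
  · rw [qmMap_diagonal_of_le_one hg₀ hφ hlam (hσ0 n) (hσ n), Function.iterate_succ_apply']
    congr 2
    -- The map `s ↦ 1 / (2 * lam * s)` is an involution, so the second step returns `τ (τ^[n] t)`
    -- exactly.
    have : τ (τ^[n] t) ≠ 0 := mul_ne_zero (Real.exp_pos _).ne' (hne n)
    simp only [σ]
    field_simp
  · refine isBounded_iff_forall_norm_le.2 ⟨‖(!₂[1, 1, 0] : E3)‖, ?_⟩
    rintro _ ⟨n, rfl⟩
    rw [norm_smul, Real.norm_eq_abs]
    exact mul_le_of_le_one_left (norm_nonneg _) (hσ n)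
  · have hv : 0 < ‖(!₂[1, 1, 0] : E3)‖ := by
      simp
    simp only [norm_smul, Real.norm_eq_abs]
    exact (tendsto_atTop_mono (fun n => (hmem n).2)
      (tendsto_pow_atTop_atTop_of_one_lt one_lt_two)).atTop_mul_const hv

end QmDyn

end

theorem lemma5p3 (L : ℝ) (hL : 1 < L) (g : QmDyn.E3 → QmDyn.E3)
    (hG1 : ∀ x : QmDyn.E3, x 2 ≤ 0 → g x = x)
    (hG2 : ∀ x : QmDyn.E3, L ≤ x 2 → g x = x + QmDyn.zorich x)
    (hG3 : ∀ x : QmDyn.E3, g (x + !₂[4, 0, 0]) = g x + !₂[4, 0, 0] ∧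
      g (x + !₂[0, 4, 0]) = g x + !₂[0, 4, 0])
    (hG4 : ∀ x : QmDyn.E3, g (QmDyn.rot 2 2 x) = QmDyn.rot 2 2 (g x))
    (φ : QmDyn.E3 → QmDyn.E3) (hφ : QmDyn.IsInverseBranch φ)
    (lam : ℝ) (hlam0 : 0 < lam) (hlam1 : lam < 1)
    (L' : ℝ) (hL' : L' = max (Real.log (1 / lam)) (Real.exp L)) :
    {x : QmDyn.E3 | ∃ t : ℝ, L' < |t| ∧ x = t • !₂[1, 1, 0]} ∪
      {x : QmDyn.E3 | ∃ t : ℝ, 0 < |t| ∧ |t| < 1 / (2 * L') ∧ x = t • !₂[1, 1, 0]}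
      ⊆ QmDyn.BU (QmDyn.qmMap lam g φ) := by
  subst hL'
  rintro x (⟨t, ht, rfl⟩ | ⟨t, ht, ht', rfl⟩)
  · exact QmDyn.diagonal_mem_BU hL hG1 hG2 hφ hlam0 ht
  · set L' := max (Real.log (1 / lam)) (Real.exp L)
    have hL'1 : 1 < L' := (Real.one_lt_exp_iff.2 (by linarith)).trans_le (le_max_right _ _)
    have hlt : |t| * (2 * L') < 1 := (lt_div_iff₀ (by linarith)).1 ht'
    -- As `L' > 1`, the inner points have `|t| < 1`, so one step leads to the parameter `1 / (2 *
    -- lam * t)`, whose modulus exceeds `L'` because `lam < 1`.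
    refine QmDyn.mem_BU_of_map_mem
      (QmDyn.qmMap_diagonal_of_le_one hG1 hφ hlam0 (abs_pos.1 ht) (by nlinarith))
      (QmDyn.diagonal_mem_BU hL hG1 hG2 hφ hlam0 ?_)
    rw [abs_div, abs_one, abs_mul, abs_two, abs_mul, abs_of_pos hlam0, lt_div_iff₀ (by positivity)]
    calc L' * (2 * (lam * |t|)) = lam * (|t| * (2 * L')) := by ring
      _ < 1 := mul_lt_one_of_nonneg_of_lt_one_left hlam0.le hlam1 hlt.le
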